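/- **Theorem.** For $n\ge 1$ let $S(n)$ be the $n$-subspace quiver, with vertices $q_0,q_1,\dots,q_n$ and one arrow $a_i:q_i\to q_0$ for each $i=1,\dots,n$, and let $\alpha(n)=2q_0+\sum_{i=1}^n q_i$. *(a)* For every $n\ge 3$ and every field $\Bbbk$, the dimension vector $\alpha(n)$ admits a cellular tree normal form over $\Bbbk$. *(b)* For every $n\ge 3$ there is a unique polynomial $a_n=a_{\alpha(n)}\in\mathbb Z[q]$ (the Kac polynomial) whose value at each prime power $q$ is the number of isomorphism classes of absolutely indecomposable representations of $S(n)$ of dimension vector $\alpha(n)$ over $\mathbb F_q$ (those that stay indecomposable over $\overline{\mathbb F}_q$). These polynomials satisfy $$a_3(q)=1,\qquad a_n(q)=(q+1)\,a_{n-1}(q)+2^{n-2}-1\quad\text{for all } n\ge 4 .$$ Here, for a quiver $Q$ and a dimension vector $\alpha$, let $R_\alpha(Q)=\bigoplus_{a}\operatorname{Hom}_\Bbbk(\Bbbk^{\alpha_{s(a)}},\Bbbk^{\alpha_{t(a)}})$, the sum being over all arrows $a$ of $Q$. Its points are the representations $M$ of $Q$ with $M_q=\Bbbk^{\alpha_q}$,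 and for $M\in R_\alpha(Q)$ we also write $R(M,M)=R_\alpha(Q)$. For $\lambda\in R(M,M)$ put $M(\lambda)=M+\lambda$. Let $\operatorname{Ext}(M,M)$ be the cokernel of $$\bigoplus_q\operatorname{End}_\Bbbk(M_q)\to R(M,M),\qquad (f_q)_q\mapsto (f_{t(a)}M_a-M_af_{s(a)})_a .$$ A *tree module* $T\in R_\alpha(Q)$ is an indecomposable representation whose coefficient quiver with respect to the standard bases is a tree. The vertices of this quiver are the standard basis vectors, with one arrow $b'\to b$ for each arrow $a$ of $Q$ such that the coefficient of $b$ in $T_a(b')$ is nonzero. A *cell of indecomposable representations* is a pair $(M,U)$ where $U\subseteq R(M,M)$ is a linear subspace that maps injectively to $\operatorname{Ext}(M,M)$, such that $M(\lambda)$ is indecomposable for every $\lambda\in U$ and $M(\lambda)\not\cong M(\mu)$ for all $\lambda\ne\mu$ in $U$. The dimension vector $\alpha$ *admits a cellular tree normal form* over $\Bbbk$ if there are finitely many cells $(T_1,U_1),\dots,(T_r,U_r)$ with each $T_i\in R_\alpha(Q)$ a tree module such that 1. $T_i(\lambda)\cong T_j(\mu)$ with $\lambda\in U_i$, $\mu\in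 U_j$ implies $i=j$; and 2. every indecomposable representation of dimension vector $\alpha$ is isomorphic to $T_i(\lambda)$ for some $i$ and some $\lambda\in U_i$. -/

import Mathlib

open Polynomial

noncomputable section

namespace QuiverRep

universe u v w

/-! ### Representations of a quiver on coordinate spaces -/

section General

variable {k : Type u} [Field k] {Q : Type v} [Quiver.{w} Q] {α β : Q → ℕ}

/-- `RepSpace k Q α β` is the space `R(N, M) = ⨁ₐ Hom(N_{s(a)}, M_{t(a)})`, where
`N_x = k ^ (α x)` and `M_x = k ^ (β x)`; linear maps are written as matrices. -/
abbrev RepSpace (k : Type u) [Field k] (Q : Type v) [Quiver.{w} Q] (α β : Q → ℕ) :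
    Type (max u v w) :=
  ∀ x y : Q, (x ⟶ y) → Matrix (Fin (β y)) (Fin (α x)) k

/-- The representation space `R_α(Q)`. Its points are the representations of `Q` with
`M_x = k ^ (α x)`, hence, up to isomorphism, all representations of dimension vector `α`. For a
representation `M` of dimension vector `α` it is also the space `R(M, M)`, and the deformation
`M(lam)` of `M` by `lam ∈ R(M, M)` is the sum `M + lam`. -/
abbrev Rep (k : Type u) [Field k] (Q : Type v) [Quiver.{w} Q] (α : Q → ℕ) :
    Type (max u v w) :=
  RepSpace k Q α α

/-- Isomorphism of representations: invertible maps at the vertices that commute with the maps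
at the arrows. -/
def Iso (M N : Rep k Q α) : Prop :=
  ∃ g : ∀ x : Q, GL (Fin (α x)) k, ∀ (x y : Q) (a : x ⟶ y),
    (g y : Matrix (Fin (α y)) (Fin (α y)) k) * M x y a =
      N x y a * (g x : Matrix (Fin (α x)) (Fin (α x)) k)

theorem Iso.refl (M : Rep k Q α) : Iso M M :=
  ⟨fun _ => 1, fun x y a => by simp⟩

theorem Iso.symm {M N : Rep k Q α} : Iso M N → Iso N M := by
  rintro ⟨g, hg⟩
  refine ⟨fun x => (g x)⁻¹, fun x y a => ?_⟩
  have h : N x y a = (g y : Matrix (Fin (α y)) (Fin (α y)) k) * M x y a *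
      (((g x)⁻¹ : GL (Fin (α x)) k) : Matrix (Fin (α x)) (Fin (α x)) k) := by
    rw [hg x y a, Matrix.mul_assoc, ← Units.val_mul, mul_inv_cancel, Units.val_one,
      Matrix.mul_one]
  rw [h, ← Matrix.mul_assoc, ← Matrix.mul_assoc, ← Units.val_mul, inv_mul_cancel,
    Units.val_one, Matrix.one_mul]

theorem Iso.trans {M N P : Rep k Q α} : Iso M N → Iso N P → Iso M P := by
  rintro ⟨g, hg⟩ ⟨h, hh⟩
  refine ⟨fun x => h x * g x, fun x y a => ?_⟩
  rw [Units.val_mul, Units.val_mul, Matrix.mul_assoc, hg x y a, ← Matrix.mul_assoc, hh x y a,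
    Matrix.mul_assoc]

/-- Isomorphism as an equivalence relation on `R_α(Q)`. -/
def isoSetoid (k : Type u) [Field k] (Q : Type v) [Quiver.{w} Q] (α : Q → ℕ) :
    Setoid (Rep k Q α) where
  r := Iso
  iseqv := ⟨Iso.refl, Iso.symm, Iso.trans⟩

/-- A family of subspaces `A_x ⊆ M_x` is a subrepresentation of `M`. -/
def IsSubrep (M : Rep k Q α) (A : ∀ x : Q, Submodule k (Fin (α x) → k)) : Prop :=
  ∀ (x y : Q) (a : x ⟶ y), ∀ v ∈ A x, (M x y a).mulVec v ∈ A y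

/-- `M` is indecomposable: it is nonzero, and it is not the direct sum of two nonzero
subrepresentations. -/
def IsIndecomposable (M : Rep k Q α) : Prop :=
  (∃ x : Q, α x ≠ 0) ∧
    ∀ A B : ∀ x : Q, Submodule k (Fin (α x) → k),
      IsSubrep M A → IsSubrep M B → (∀ x, IsCompl (A x) (B x)) →
        (∀ x, A x = ⊥) ∨ (∀ x, B x = ⊥)

/-! ### Extensions and cells -/

/-- The map `d_{N,M} : ⨁ₓ Hom(N_x, M_x) → R(N, M)`, `(f_x) ↦ (f_{t(a)} N_a - M_a f_{s(a)})`. -/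
def extDifferential (N : Rep k Q α) (M : Rep k Q β) :
    (∀ x : Q, Matrix (Fin (β x)) (Fin (α x)) k) →ₗ[k] RepSpace k Q α β where
  toFun f := fun x y a => f y * N x y a - M x y a * f x
  map_add' f g := by
    funext x y a
    simp only [Pi.add_apply, Matrix.add_mul, Matrix.mul_add]
    abel
  map_smul' c f := by
    funext x y a
    simp [smul_sub]

/-- `Ext(N, M)`, as the cokernel of `d_{N,M}`. -/
abbrev Ext (N : Rep k Q α) (M : Rep k Q β) : Type (max u v w) :=
  RepSpace k Q α β ⧸ LinearMap.range (extDifferential N M)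

/-- The projection `π_{N,M} : R(N, M) → Ext(N, M)`. -/
def extProj (N : Rep k Q α) (M : Rep k Q β) : RepSpace k Q α β →ₗ[k] Ext N M :=
  (LinearMap.range (extDifferential N M)).mkQ

/-- `U ⊆ R(N, M)` represents the subset `E` of `Ext(N, M)`. -/
def Represents (N : Rep k Q α) (M : Rep k Q β) (U : Set (RepSpace k Q α β))
    (E : Set (Ext N M)) : Prop :=
  Set.BijOn (extProj N M) U E

/-- `U ⊆ R(M, M)` is strong: all deformations `M(lam)`, `lam ∈ U`, are indecomposable. -/
def IsStrong (M : Rep k Q α) (U : Set (Rep k Q α)) : Prop :=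
  ∀ lam ∈ U, IsIndecomposable (M + lam)

/-- `U ⊆ R(M, M)` is separating: distinct parameters give nonisomorphic deformations. -/
def IsSeparating (M : Rep k Q α) (U : Set (Rep k Q α)) : Prop :=
  ∀ lam ∈ U, ∀ mu ∈ U, lam ≠ mu → ¬ Iso (M + lam) (M + mu)

/-- `(M, U)` is a cell of indecomposable representations: the linear subspace `U` of `R(M, M)`
is strong and separating and represents a subset of `Ext(M, M)`. -/
def IsCell (M : Rep k Q α) (U : Submodule k (Rep k Q α)) : Prop :=
  (∃ E : Set (Ext M M), Represents M M (U : Set (Rep k Q α)) E) ∧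
    IsStrong M (U : Set (Rep k Q α)) ∧ IsSeparating M (U : Set (Rep k Q α))

/-- A mosaic of indecomposable representations: finitely many cells such that representations
in different cells are not isomorphic. -/
def IsMosaic {r : ℕ} (M : Fin r → Rep k Q α) (U : Fin r → Submodule k (Rep k Q α)) : Prop :=
  (∀ i, IsCell (M i) (U i)) ∧
    ∀ i j, ∀ lam ∈ U i, ∀ mu ∈ U j, Iso (M i + lam) (M j + mu) → i = j

/-! ### Tree modules and tree normal forms -/

/-- The vertices of the coefficient quiver of `M` with respect to the standard basis: the
elements of the standard bases of the spaces `M_x`. -/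
abbrev CoeffVertex (α : Q → ℕ) : Type v := Σ x : Q, Fin (α x)

/-- The arrows `b' ⟶ b` of the coefficient quiver of `M`: the arrows `a` of `Q` for which the
coefficient of `b` in `M_a(b')` is nonzero. -/
def CoeffArrow (M : Rep k Q α) (b' b : CoeffVertex α) :=
  { a : b'.1 ⟶ b.1 // M b'.1 b.1 a b.2 b'.2 ≠ 0 }

/-- The underlying (simple) graph of the coefficient quiver; it is used for connectedness only,
the arrows are counted in the quiver itself. -/
def coeffGraph (M : Rep k Q α) : SimpleGraph (CoeffVertex α) :=
  SimpleGraph.fromRel fun b' b => Nonempty (CoeffArrow M b' b)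

/-- `M ∈ R_α(Q)` is a tree module in the given matrix form: it is indecomposable and its
coefficient quiver with respect to the standard basis is a tree, i.e. it is (finite and)
connected and has exactly one fewer arrow than it has vertices. -/
def IsTreeModule (M : Rep k Q α) : Prop :=
  IsIndecomposable M ∧ (coeffGraph M).Connected ∧
    Finite (Σ b' : CoeffVertex α, Σ b : CoeffVertex α, CoeffArrow M b' b) ∧
    Nat.card (Σ b' : CoeffVertex α, Σ b : CoeffVertex α, CoeffArrow M b' b) + 1 =
      Nat.card (CoeffVertex α)

/-- `M` has a `(T, U)`-normal form. -/
def HasNormalForm (T : Rep k Q α) (U : Set (Rep k Q α)) (M : Rep k Q α) : Prop :=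
  ∃ lam ∈ U, Iso M (T + lam)

/-- The dimension vector `α` admits a cellular tree normal form over `k`: there is a finite
mosaic `(T_i, U_i)` of indecomposable representations in which all `T_i` are tree modules, such
that every indecomposable representation of dimension vector `α` has a `(T_i, U_i)`-normal form
for some `i`. -/
def AdmitsCellularTreeNormalForm (k : Type u) [Field k] (Q : Type v) [Quiver.{w} Q]
    (α : Q → ℕ) : Prop :=
  ∃ (r : ℕ) (T : Fin r → Rep k Q α) (U : Fin r → Submodule k (Rep k Q α)),
    (∀ i, IsTreeModule (T i)) ∧ IsMosaic T U ∧
      ∀ M : Rep k Q α, IsIndecomposable M →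
        ∃ i, HasNormalForm (T i) (U i : Set (Rep k Q α)) M

/-! ### Kac polynomials -/

/-- Extension of scalars from `k` to its algebraic closure. -/
def toClosure (M : Rep k Q α) : Rep (AlgebraicClosure k) Q α :=
  fun x y a => (M x y a).map (algebraMap k (AlgebraicClosure k))

/-- `M` is absolutely indecomposable: it is indecomposable over the algebraic closure. -/
def IsAbsolutelyIndecomposable (M : Rep k Q α) : Prop :=
  IsIndecomposable (toClosure M)

/-- The number of isomorphism classes of absolutely indecomposable representations of dimension
vector `α` over `k` (for finite `k` and finite `Q`). -/
def absIndecCount (k : Type u) [Field k] (Q : Type v) [Quiver.{w} Q] (α : Q → ℕ) : ℕ :=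
  Set.ncard (Quotient.mk (isoSetoid k Q α) '' { M | IsAbsolutelyIndecomposable M })

end General

/-- The polynomial `p` counts, for every finite field with `q` elements, the isomorphism classes
of absolutely indecomposable representations of dimension vector `α` over that field. -/
def IsKacPolynomial (Q : Type v) [Quiver.{w} Q] (α : Q → ℕ) (p : ℤ[X]) : Prop :=
  ∀ (F : Type) [Field F] [Finite F], p.eval (Nat.card F : ℤ) = (absIndecCount F Q α : ℤ)

theorem IsKacPolynomial.unique {Q : Type v} [Quiver.{w} Q] {α : Q → ℕ} {p p' : ℤ[X]}
    (h : IsKacPolynomial Q α p) (h' : IsKacPolynomial Q α p') : p = p' := by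
  refine Polynomial.eq_of_infinite_eval_eq p p'
    (((Nat.infinite_setOfPred_prime).image (f := fun n : ℕ => (n : ℤ))
      (Nat.cast_injective.injOn)).mono ?_)
  rintro _ ⟨l, hl, rfl⟩
  have : Fact l.Prime := ⟨hl⟩
  have e := (h (ZMod l)).trans (h' (ZMod l)).symm
  rwa [Nat.card_zmod] at e

open Classical in
/-- The Kac polynomial `a_α(q)`. The value is meaningful if some polynomial satisfies
`IsKacPolynomial`, and is then the only such polynomial. -/
def kacPolynomial (Q : Type v) [Quiver.{w} Q] (α : Q → ℕ) : ℤ[X] :=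
  if h : ∃ p : ℤ[X], IsKacPolynomial Q α p then h.choose else 0

/-! ### The subspace quiver -/

/-- The vertices `q_0` and `q_1, …, q_n` of the `n`-subspace quiver `S(n)`. -/
inductive SubspaceQuiver (n : ℕ) : Type
  | center : SubspaceQuiver n
  | leaf (i : Fin n) : SubspaceQuiver n

/-- The arrows of `S(n)`: one arrow from each `leaf i` to `center`. -/
inductive SubspaceQuiver.Arrow (n : ℕ) : SubspaceQuiver n → SubspaceQuiver n → Type
  | arrow (i : Fin n) : SubspaceQuiver.Arrow n (SubspaceQuiver.leaf i) SubspaceQuiver.center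

instance (n : ℕ) : Quiver (SubspaceQuiver n) where
  Hom := SubspaceQuiver.Arrow n

/-- The dimension vector `α(n) = 2 q_0 + q_1 + ⋯ + q_n`. -/
def subspaceDim (n : ℕ) : SubspaceQuiver n → ℕ
  | SubspaceQuiver.center => 2
  | SubspaceQuiver.leaf _ => 1

end QuiverRep

end

/-! A representation of dimension `subspaceDim n` is an `n`-tuple of vectors in `k ^ 2`, its
columns, up to `GL₂` and independent rescaling of the columns. It is indecomposable exactly when no
column vanishes and the columns span at least three distinct lines (`isIndecomposable_iff`). This is
a condition on nonvanishing of coordinates and determinants, so it agrees with absolute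
indecomposability.

The isomorphism classes are thus the `PGL₂`-orbits of tuples of points of the projective line with
at least three distinct entries. Since `PGL₂` is simply transitive on triples of distinct points,
each orbit has one normal form: the first point is `∞`, the next different one is `0`, the next
different from both is `1`, and the later ones are arbitrary (`exists_normal_form`,
`IsNormalAt.eq_of_iso`).

Fixing the place of this `1` and the set of places with `∞` cuts the normal forms into affine
spaces, whose coordinates are the finite points after the `1`. These are the cells. At the centre
all coordinates are `0`, so all columns are standard basis vectors except for a single `(1, 1)`, and
the coefficient quiver is a tree.

For the count, the last point is removed. Either the rest is already in normal form and the last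
point is one of `q + 1`, or the last point is the `1` that fixes the frame and the rest is a word in
`∞` and `0` that begins with `∞` and contains `0`. For `n` points there are `2 ^ (n - 2) - 1` such
words. -/

namespace QuiverRep

universe u

variable {k : Type u} [Field k] {n : ℕ}

/-! ### Representations as tuples of vectors in the plane -/

/-- The vector in `k ^ 2` that spans the image of the `i`-th arrow. -/
def column (M : Rep k (SubspaceQuiver n) (subspaceDim n)) (i : Fin n) : Fin 2 → k :=
  fun r => M _ _ (SubspaceQuiver.Arrow.arrow i) r (0 : Fin 1)

/-- The representation of the subspace quiver with given columns. -/
def ofColumns (v : Fin n → Fin 2 → k) : Rep k (SubspaceQuiver n) (subspaceDim n) :=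
  fun _ _ a => match a with
    | SubspaceQuiver.Arrow.arrow i => Matrix.of fun r _ => v i r

theorem column_add (M N : Rep k (SubspaceQuiver n) (subspaceDim n)) (i : Fin n) :
    column (M + N) i = column M i + column N i := rfl

theorem ext_column {M N : Rep k (SubspaceQuiver n) (subspaceDim n)}
    (h : ∀ i, column M i = column N i) : M = N := by
  funext x y a
  change SubspaceQuiver.Arrow n x y at a
  cases a with
  | arrow i =>
    ext r s
    have hs : s = (0 : Fin 1) := Subsingleton.elim (α := Fin 1) s 0
    subst hs
    exact congrFun (h i) r

/-- The determinant of a pair of vectors in the plane. -/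
def planeDet (v w : Fin 2 → k) : k := v 0 * w 1 - v 1 * w 0

theorem iso_iff_columns {M N : Rep k (SubspaceQuiver n) (subspaceDim n)} :
    Iso M N ↔ ∃ (g : GL (Fin 2) k) (c : Fin n → kˣ),
      ∀ i, (g : Matrix (Fin 2) (Fin 2) k).mulVec (column M i) = (c i : k) • column N i := by
  constructor
  · rintro ⟨g, hg⟩
    -- The determinant identifies `GL₁` with `kˣ`; on a `1 × 1` matrix it is the only entry.
    refine ⟨g SubspaceQuiver.center,
      fun i => Matrix.GeneralLinearGroup.det (g (SubspaceQuiver.leaf i)), fun i => ?_⟩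
    funext r
    have h := congrFun (congrFun (hg _ _ (SubspaceQuiver.Arrow.arrow i)) r) (0 : Fin 1)
    have e : ((Matrix.GeneralLinearGroup.det (g (SubspaceQuiver.leaf i)) : kˣ) : k) =
      Units.val (α := Matrix (Fin 1) (Fin 1) k) (g (SubspaceQuiver.leaf i)) 0 0 :=
      Matrix.det_fin_one _
    rw [e, Pi.smul_apply, smul_eq_mul, mul_comm]
    refine Eq.trans h ?_
    exact Fin.sum_univ_one
      (fun j : Fin 1 => N _ _ (SubspaceQuiver.Arrow.arrow i) r j *
        Units.val (α := Matrix (Fin 1) (Fin 1) k) (g (SubspaceQuiver.leaf i)) j 0)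
  · rintro ⟨g, c, h⟩
    refine ⟨fun x => match x with
      | SubspaceQuiver.center => g
      | SubspaceQuiver.leaf i => Units.map (Matrix.scalar (Fin 1)).toMonoidHom (c i), ?_⟩
    intro x y a
    change SubspaceQuiver.Arrow n x y at a
    cases a with
    | arrow i =>
      ext r s
      have hs : s = (0 : Fin 1) := Subsingleton.elim (α := Fin 1) s 0
      subst hs
      have h' := congrFun (h i) r
      refine Eq.trans h' (Eq.trans ?_ (Fin.sum_univ_one
        (fun j : Fin 1 => N _ _ (SubspaceQuiver.Arrow.arrow i) r j *
          (Matrix.scalar (Fin 1) (c i : k)) j 0)).symm)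
      rw [Matrix.scalar_apply, Matrix.diagonal_apply_eq]
      exact mul_comm _ _

/-! ### Determinants and lines in the plane -/

theorem planeDet_self (v : Fin 2 → k) : planeDet v v = 0 := by unfold planeDet; ring

theorem planeDet_swap (v w : Fin 2 → k) : planeDet v w = -planeDet w v := by
  unfold planeDet; ring

theorem planeDet_ne_zero_swap {v w : Fin 2 → k} (h : planeDet v w ≠ 0) : planeDet w v ≠ 0 := by
  rw [planeDet_swap]; exact neg_ne_zero.2 h

theorem ne_zero_iff_coord (v : Fin 2 → k) : v ≠ 0 ↔ v 0 ≠ 0 ∨ v 1 ≠ 0 := by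
  rw [← not_and_or, not_iff_not]
  exact ⟨fun h => by simp [h], fun h => by funext r; fin_cases r <;> simp [h.1, h.2]⟩

/-- Either coordinate of `v` times `planeDet u w` is a combination of the two vanishing
determinants, and one coordinate of `v` is nonzero. -/
theorem planeDet_trans {u v w : Fin 2 → k} (hv : v ≠ 0) (h : planeDet u v = 0)
    (h' : planeDet v w = 0) : planeDet u w = 0 := by
  unfold planeDet at *
  rcases (ne_zero_iff_coord v).1 hv with h0 | h0
  · refine (mul_eq_zero.1 ?_).resolve_left h0
    linear_combination u 0 * h' + w 0 * h
  · refine (mul_eq_zero.1 ?_).resolve_left h0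
    linear_combination u 1 * h' + w 1 * h

theorem mem_span_of_planeDet_eq_zero {v w : Fin 2 → k} (hv : v ≠ 0) (h : planeDet v w = 0) :
    w ∈ Submodule.span k {v} := by
  rw [Submodule.mem_span_singleton]
  unfold planeDet at h
  rcases (ne_zero_iff_coord v).1 hv with h0 | h0
  · refine ⟨w 0 / v 0, funext fun r => ?_⟩
    fin_cases r
    · simp [h0]
    · simp only [Fin.mk_one, Pi.smul_apply, smul_eq_mul]
      field_simp
      linear_combination -h
  · refine ⟨w 1 / v 1, funext fun r => ?_⟩
    fin_cases r
    · simp only [Fin.zero_eta, Pi.smul_apply, smul_eq_mul]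
      field_simp
      linear_combination h
    · simp [h0]

/-- Cramer's rule writes every vector in terms of `v` and `w`. -/
theorem mem_of_planeDet_ne_zero {v w : Fin 2 → k} (h : planeDet v w ≠ 0)
    {A : Submodule k (Fin 2 → k)} (hv : v ∈ A) (hw : w ∈ A) : A = ⊤ := by
  rw [eq_top_iff]
  intro x _
  have : x = (planeDet x w / planeDet v w) • v + (planeDet v x / planeDet v w) • w := by
    funext r
    simp only [Pi.add_apply, Pi.smul_apply, smul_eq_mul]
    field_simp
    unfold planeDet
    fin_cases r <;> simp <;> ring
  rw [this]
  exact A.add_mem (A.smul_mem _ hv) (A.smul_mem _ hw)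

theorem isCompl_span_of_planeDet_ne_zero {v w : Fin 2 → k} (h : planeDet v w ≠ 0) :
    IsCompl (Submodule.span k {v}) (Submodule.span k {w}) := by
  constructor
  · rw [Submodule.disjoint_def]
    intro x hx hx'
    obtain ⟨a, rfl⟩ := Submodule.mem_span_singleton.1 hx
    obtain ⟨b, hb⟩ := Submodule.mem_span_singleton.1 hx'
    have h0 := congrFun hb 0
    have h1 := congrFun hb 1
    simp only [Pi.smul_apply, smul_eq_mul] at h0 h1
    have : a * planeDet v w = 0 := by
      unfold planeDet
      linear_combination w 0 * h1 - w 1 * h0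
    rw [(mul_eq_zero.1 this).resolve_right h, zero_smul]
  · rw [codisjoint_iff]
    exact mem_of_planeDet_ne_zero h
      (Submodule.mem_sup_left (Submodule.mem_span_singleton_self v))
      (Submodule.mem_sup_right (Submodule.mem_span_singleton_self w))

/-! ### The criterion for indecomposability -/

/-- Subspaces at the vertices of the subspace quiver. -/
def subspaceFamily (A : Submodule k (Fin 2 → k)) (B : Fin n → Submodule k (Fin 1 → k)) :
    ∀ x : SubspaceQuiver n, Submodule k (Fin (subspaceDim n x) → k)
  | SubspaceQuiver.center => A
  | SubspaceQuiver.leaf i => B i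

theorem mulVec_arrow (M : Rep k (SubspaceQuiver n) (subspaceDim n)) (i : Fin n)
    (v : Fin 1 → k) :
    (M _ _ (SubspaceQuiver.Arrow.arrow i)).mulVec v = v 0 • column M i := by
  funext r
  refine Eq.trans (Fin.sum_univ_one
    (fun j : Fin 1 => M _ _ (SubspaceQuiver.Arrow.arrow i) r j * v j)) ?_
  exact mul_comm _ _

theorem isSubrep_subspaceFamily {M : Rep k (SubspaceQuiver n) (subspaceDim n)}
    {A : Submodule k (Fin 2 → k)} {B : Fin n → Submodule k (Fin 1 → k)}
    (h : ∀ i, B i ≠ ⊥ → column M i ∈ A) : IsSubrep M (subspaceFamily A B) := by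
  intro x y a v hv
  change SubspaceQuiver.Arrow n x y at a
  cases a with
  | arrow i =>
    revert v
    change ∀ v : Fin 1 → k, v ∈ B i → (M _ _ (SubspaceQuiver.Arrow.arrow i)).mulVec v ∈ A
    intro v hv
    rw [mulVec_arrow M i v]
    by_cases hB : B i = ⊥
    · have hv' : v ∈ B i := hv
      rw [hB, Submodule.mem_bot] at hv'
      rw [hv', Pi.zero_apply, zero_smul]
      exact A.zero_mem
    · exact A.smul_mem _ (h i hB)

/-- The space at a leaf is a line, so a nonzero subspace contains a vector whose image is a nonzero
multiple of the column. -/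
theorem column_mem_of_isSubrep {M : Rep k (SubspaceQuiver n) (subspaceDim n)}
    {A : ∀ x, Submodule k (Fin (subspaceDim n x) → k)} (hA : IsSubrep M A) (i : Fin n)
    (h : A (SubspaceQuiver.leaf i) ≠ ⊥) : column M i ∈ A SubspaceQuiver.center := by
  obtain ⟨v, hv, hv0⟩ : ∃ v : Fin 1 → k, v ∈ A (SubspaceQuiver.leaf i) ∧ v ≠ 0 := by
    obtain ⟨v, hv⟩ := Submodule.exists_mem_ne_zero_of_ne_bot h
    exact ⟨v, hv⟩
  have h1 : v 0 • column M i ∈ A SubspaceQuiver.center := by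
    rw [← mulVec_arrow M i v]
    exact hA _ _ (SubspaceQuiver.Arrow.arrow i) v hv
  have hv1 : v 0 ≠ 0 := by
    intro h0
    apply hv0
    funext r
    have hr : r = (0 : Fin 1) := Subsingleton.elim (α := Fin 1) r 0
    rw [hr]
    exact h0
  exact (Submodule.smul_mem_iff (A SubspaceQuiver.center) hv1).1 h1

/-- The columns are nonzero and three of them are pairwise independent. -/
def HasThreeLines (v : Fin n → Fin 2 → k) : Prop :=
  (∀ i, v i ≠ 0) ∧ ∃ a b c, planeDet (v a) (v b) ≠ 0 ∧ planeDet (v b) (v c) ≠ 0 ∧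
    planeDet (v a) (v c) ≠ 0

theorem exists_planeDet_ne_zero {v : Fin 2 → k} (hv : v ≠ 0) : ∃ w, planeDet v w ≠ 0 := by
  rcases (ne_zero_iff_coord v).1 hv with h0 | h0
  · exact ⟨![0, 1], by simpa [planeDet] using h0⟩
  · exact ⟨![1, 0], by simpa [planeDet] using h0⟩

/-- A nonzero space at a leaf would force a nonzero column into the space at the centre; so the
centre alone detects whether a subrepresentation vanishes. -/
theorem leaf_ne_bot_of_left_bot {M : Rep k (SubspaceQuiver n) (subspaceDim n)}
    {A : ∀ x, Submodule k (Fin (subspaceDim n x) → k)} (hM : ∀ i, column M i ≠ 0)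
    (hA : IsSubrep M A) (h : A SubspaceQuiver.center = ⊥) : ∀ x, A x = ⊥ := by
  rintro (_ | i)
  · exact h
  · by_contra hi
    have := column_mem_of_isSubrep hA i hi
    rw [h] at this
    exact hM i ((Submodule.mem_bot k).1 this)

/-- Each leaf belongs to one of the two summands, so each column lies in one of the two central
spaces. By pigeonhole two of the three independent columns lie in the same one, which is then the
whole plane; the other summand vanishes. -/
theorem isIndecomposable_of_hasThreeLines {M : Rep k (SubspaceQuiver n) (subspaceDim n)}
    (h : HasThreeLines (column M)) : IsIndecomposable M := by
  obtain ⟨hM, a, b, c, hab, hbc, hac⟩ := h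
  refine ⟨⟨SubspaceQuiver.center, two_ne_zero⟩, fun A B hA hB hAB => ?_⟩
  have key : ∀ i, column M i ∈ A SubspaceQuiver.center ∨ column M i ∈ B SubspaceQuiver.center := by
    intro i
    by_cases hi : A (SubspaceQuiver.leaf i) = ⊥
    · refine Or.inr (column_mem_of_isSubrep hB i fun hi' => ?_)
      have h1 := (hAB (SubspaceQuiver.leaf i)).sup_eq_top
      rw [hi, hi', bot_sup_eq] at h1
      have h2 : Nontrivial (Submodule k (Fin 1 → k)) := inferInstance
      exact (bot_ne_top (α := Submodule k (Fin 1 → k))) h1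
    · exact Or.inl (column_mem_of_isSubrep hA i hi)
  have topA : A SubspaceQuiver.center = ⊤ → ∀ x, B x = ⊥ := fun ht =>
    leaf_ne_bot_of_left_bot hM hB (by
      have := (hAB SubspaceQuiver.center).inf_eq_bot
      rwa [ht, top_inf_eq] at this)
  have topB : B SubspaceQuiver.center = ⊤ → ∀ x, A x = ⊥ := fun ht =>
    leaf_ne_bot_of_left_bot hM hA (by
      have := (hAB SubspaceQuiver.center).inf_eq_bot
      rwa [ht, inf_top_eq] at this)
  rcases key a with ha | ha <;> rcases key b with hb | hb <;> rcases key c with hc | hc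
  · exact Or.inr (topA (mem_of_planeDet_ne_zero hab ha hb))
  · exact Or.inr (topA (mem_of_planeDet_ne_zero hab ha hb))
  · exact Or.inr (topA (mem_of_planeDet_ne_zero hac ha hc))
  · exact Or.inl (topB (mem_of_planeDet_ne_zero hbc hb hc))
  · exact Or.inr (topA (mem_of_planeDet_ne_zero hbc hb hc))
  · exact Or.inl (topB (mem_of_planeDet_ne_zero hac ha hc))
  · exact Or.inl (topB (mem_of_planeDet_ne_zero hab ha hb))
  · exact Or.inl (topB (mem_of_planeDet_ne_zero hab ha hb))

/-- The plane splits into the lines of `u` and `w`, and each leaf is assigned to a line that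
contains its column. -/
theorem not_isIndecomposable_of_two_lines {M : Rep k (SubspaceQuiver n) (subspaceDim n)}
    {u w : Fin 2 → k} (huw : planeDet u w ≠ 0)
    (h : ∀ i, planeDet u (column M i) = 0 ∨ planeDet w (column M i) = 0) :
    ¬ IsIndecomposable M := by
  classical
  have hu : u ≠ 0 := by rintro rfl; simp [planeDet] at huw
  have hw : w ≠ 0 := by rintro rfl; simp [planeDet] at huw
  rintro ⟨-, hM⟩
  have hcompl := isCompl_span_of_planeDet_ne_zero huw
  rcases hM
    (subspaceFamily (Submodule.span k {u})
      fun i => if planeDet u (column M i) = 0 then ⊤ else ⊥)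
    (subspaceFamily (Submodule.span k {w})
      fun i => if planeDet u (column M i) = 0 then ⊥ else ⊤)
    (isSubrep_subspaceFamily fun i hi => by
      by_cases hd : planeDet u (column M i) = 0
      · exact mem_span_of_planeDet_eq_zero hu hd
      · simp [hd] at hi)
    (isSubrep_subspaceFamily fun i hi => by
      by_cases hd : planeDet u (column M i) = 0
      · simp [hd] at hi
      · exact mem_span_of_planeDet_eq_zero hw ((h i).resolve_left hd))
    (by
      rintro (_ | i)
      · exact hcompl
      · by_cases hd : planeDet u (column M i) = 0
        · simp only [subspaceFamily, hd, if_true]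
          exact isCompl_top_bot
        · simp only [subspaceFamily, hd, if_false]
          exact isCompl_bot_top) with h0 | h0
  · exact hu (Submodule.span_singleton_eq_bot.1 (h0 SubspaceQuiver.center))
  · exact hw (Submodule.span_singleton_eq_bot.1 (h0 SubspaceQuiver.center))

/-- A zero column splits off the simple representation at its leaf. -/
theorem column_ne_zero_of_isIndecomposable {M : Rep k (SubspaceQuiver n) (subspaceDim n)}
    (h : IsIndecomposable M) (i : Fin n) : column M i ≠ 0 := by
  classical
  intro hi
  rcases h.2
    (subspaceFamily ⊥ fun l => if l = i then ⊤ else ⊥)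
    (subspaceFamily ⊤ fun l => if l = i then ⊥ else ⊤)
    (isSubrep_subspaceFamily fun l hl => by
      by_cases hli : l = i
      · rw [hli, hi]; exact Submodule.zero_mem _
      · simp [hli] at hl)
    (isSubrep_subspaceFamily fun l hl => Submodule.mem_top)
    (by
      rintro (_ | l)
      · exact isCompl_bot_top
      · by_cases hd : l = i
        · simp only [subspaceFamily, hd, if_true]
          exact isCompl_top_bot
        · simp only [subspaceFamily, hd, if_false]
          exact isCompl_bot_top) with h0 | h0
  · have h1 := h0 (SubspaceQuiver.leaf i)
    simp only [subspaceFamily, if_true] at h1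
    exact (top_ne_bot (α := Submodule k (Fin 1 → k))) h1
  · exact (top_ne_bot (α := Submodule k (Fin 2 → k))) (h0 SubspaceQuiver.center)

/-- Without three lines the columns lie on two: the line of column `0`, and that of a column
independent of it or, if there is none, any auxiliary line. -/
theorem hasThreeLines_of_isIndecomposable {m : ℕ}
    {M : Rep k (SubspaceQuiver (m + 1)) (subspaceDim (m + 1))}
    (h : IsIndecomposable M) : HasThreeLines (column M) := by
  have hM := column_ne_zero_of_isIndecomposable h
  refine ⟨hM, ?_⟩
  by_contra! hno
  by_cases hall : ∀ i, planeDet (column M 0) (column M i) = 0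
  · obtain ⟨w, hw⟩ := exists_planeDet_ne_zero (hM 0)
    exact not_isIndecomposable_of_two_lines hw (fun i => Or.inl (hall i)) h
  · push Not at hall
    obtain ⟨b, hb⟩ := hall
    refine not_isIndecomposable_of_two_lines hb (fun i => ?_) h
    by_contra! hi
    exact hi.1 (hno 0 b i hb hi.2)

theorem isIndecomposable_iff {m : ℕ} {M : Rep k (SubspaceQuiver (m + 1)) (subspaceDim (m + 1))} :
    IsIndecomposable M ↔ HasThreeLines (column M) :=
  ⟨hasThreeLines_of_isIndecomposable, isIndecomposable_of_hasThreeLines⟩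

/-- The criterion only asks whether certain elements of `k` vanish, which does not change in the
closure. -/
theorem isAbsolutelyIndecomposable_iff {m : ℕ}
    {M : Rep k (SubspaceQuiver (m + 1)) (subspaceDim (m + 1))} :
    IsAbsolutelyIndecomposable M ↔ IsIndecomposable M := by
  have hc : ∀ i, column (toClosure M) i =
      fun r => algebraMap k (AlgebraicClosure k) (column M i r) := fun i => rfl
  have hd : ∀ i j, planeDet (column (toClosure M) i) (column (toClosure M) j) =
      algebraMap k (AlgebraicClosure k) (planeDet (column M i) (column M j)) := fun i j => by
    simp [hc, planeDet]
  rw [IsAbsolutelyIndecomposable, isIndecomposable_iff, isIndecomposable_iff]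
  unfold HasThreeLines
  simp only [hd]
  simp only [ne_zero_iff_coord, hc, ne_eq, FaithfulSMul.algebraMap_eq_zero_iff]

/-! ### Normal forms -/

/-- The standard spanning vector of a point of the projective line `k ∪ {∞}`. -/
def pointVec : Option k → Fin 2 → k
  | none => ![1, 0]
  | some t => ![t, 1]

theorem pointVec_ne_zero (o : Option k) : pointVec o ≠ 0 := by
  rw [ne_zero_iff_coord]
  cases o <;> simp [pointVec]

theorem planeDet_pointVec_eq_zero_iff {o p : Option k} :
    planeDet (pointVec o) (pointVec p) = 0 ↔ o = p := by
  cases o <;> cases p <;> simp [pointVec, planeDet, sub_eq_zero]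

theorem exists_eq_smul_pointVec {y : Fin 2 → k} (hy : y ≠ 0) :
    ∃ (o : Option k) (c : kˣ), y = (c : k) • pointVec o := by
  by_cases h : y 1 = 0
  · have h0 : y 0 ≠ 0 := ((ne_zero_iff_coord y).1 hy).resolve_right (not_not.2 h)
    refine ⟨none, Units.mk0 _ h0, ?_⟩
    funext r
    fin_cases r <;> simp [pointVec, h]
  · refine ⟨some (y 0 / y 1), Units.mk0 _ h, ?_⟩
    funext r
    fin_cases r <;> simp [pointVec, mul_div_cancel₀, h]

theorem planeDet_smul (a b : k) (v w : Fin 2 → k) :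
    planeDet (a • v) (b • w) = a * b * planeDet v w := by
  simp only [planeDet, Pi.smul_apply, smul_eq_mul]; ring

theorem planeDet_mulVec (g : Matrix (Fin 2) (Fin 2) k) (v w : Fin 2 → k) :
    planeDet (g.mulVec v) (g.mulVec w) = g.det * planeDet v w := by
  simp only [planeDet, Matrix.mulVec, dotProduct, Fin.sum_univ_two, Matrix.det_fin_two]; ring

/-- A configuration of points of the projective line in normal form: it starts with `∞`, and its
first point that is neither `∞` nor `0` is `1`, and comes after a point `0`. -/
def IsNormalAt {m : ℕ} (c : Fin (m + 1) → Option k) (j : Fin (m + 1)) : Prop :=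
  c 0 = none ∧ c j = some 1 ∧ (∃ i < j, c i = some 0) ∧ ∀ i < j, c i = none ∨ c i = some 0

/-- The representation given by a configuration of points of the projective line. -/
def ofPoints (c : Fin n → Option k) : Rep k (SubspaceQuiver n) (subspaceDim n) :=
  ofColumns fun i => pointVec (c i)

theorem column_ofPoints (c : Fin n → Option k) (i : Fin n) :
    column (ofPoints c) i = pointVec (c i) := rfl

variable {m : ℕ}

theorem IsNormalAt.isIndecomposable {c : Fin (m + 1) → Option k} {j : Fin (m + 1)}
    (h : IsNormalAt c j) : IsIndecomposable (ofPoints c) := by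
  obtain ⟨h0, hj, ⟨i, -, hi⟩, -⟩ := h
  refine isIndecomposable_of_hasThreeLines ⟨fun i => pointVec_ne_zero _, 0, i, j, ?_⟩
  simp only [column_ofPoints, ne_eq, planeDet_pointVec_eq_zero_iff, h0, hj, hi]
  simp

theorem IsNormalAt.index_unique {c : Fin (m + 1) → Option k} {j j' : Fin (m + 1)}
    (h : IsNormalAt c j) (h' : IsNormalAt c j') : j = j' := by
  rcases lt_trichotomy j j' with hlt | rfl | hlt
  · have := h'.2.2.2 j hlt
    simp [h.2.1] at this
  · rfl
  · have := h.2.2.2 j' hlt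
    simp [h'.2.1] at this

/-- The index `j` is minimal such that `v 0`, `v j` and some earlier column are pairwise
independent. A column before `j` independent of both `v 0` and `v i` would form, with `v 0` and `v
i`, such a triple ending before `j`. -/
theorem exists_first_independent_triple {v : Fin (m + 1) → Fin 2 → k} (h : HasThreeLines v) :
    ∃ i j, i < j ∧ planeDet (v 0) (v i) ≠ 0 ∧ planeDet (v 0) (v j) ≠ 0 ∧
      planeDet (v i) (v j) ≠ 0 ∧ ∀ l < j, planeDet (v 0) (v l) = 0 ∨ planeDet (v i) (v l) = 0 := by
  obtain ⟨h0, a, b, c, hab, hbc, hac⟩ := h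
  let P : Fin (m + 1) → Prop := fun j => ∃ i < j, planeDet (v 0) (v i) ≠ 0 ∧
    planeDet (v 0) (v j) ≠ 0 ∧ planeDet (v i) (v j) ≠ 0
  have pair : ∀ x y, planeDet (v 0) (v x) ≠ 0 → planeDet (v 0) (v y) ≠ 0 →
      planeDet (v x) (v y) ≠ 0 → ∃ j, P j := by
    intro x y hx hy hxy
    rcases lt_trichotomy x y with hlt | rfl | hlt
    · exact ⟨y, x, hlt, hx, hy, hxy⟩
    · exact absurd (planeDet_self _) hxy
    · exact ⟨x, y, hlt, hy, hx, planeDet_ne_zero_swap hxy⟩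
  have par : ∀ x y, planeDet (v x) (v y) ≠ 0 → planeDet (v 0) (v x) = 0 →
      planeDet (v 0) (v y) ≠ 0 := fun x y hxy hx hy =>
    hxy (planeDet_trans (h0 0) (by rw [planeDet_swap, hx, neg_zero]) hy)
  -- At most one of three distinct lines is that of `v 0`; two of the others complete `v 0` to a
  -- triple.
  have hP : ∃ j, P j := by
    by_cases ha : planeDet (v 0) (v a) = 0
    · exact pair b c (par _ _ hab ha) (par _ _ hac ha) hbc
    · by_cases hb : planeDet (v 0) (v b) = 0
      · exact pair a c ha (par _ _ hbc hb) hac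
      · exact pair a b ha hb hab
  obtain ⟨j, ⟨i, hij, hi, hj, hd⟩, hmin⟩ := WellFounded.has_min (wellFounded_lt) {j | P j} hP
  refine ⟨i, j, hij, hi, hj, hd, fun l hl => ?_⟩
  by_contra! hcon
  rcases lt_trichotomy l i with hlt | rfl | hlt
  · exact hmin i ⟨l, hlt, hcon.1, hi, planeDet_ne_zero_swap hcon.2⟩ hij
  · exact hcon.2 (planeDet_self _)
  · exact hmin l ⟨i, hlt, hi, hcon.1, hcon.2⟩ hl

theorem exists_normal_form {M : Rep k (SubspaceQuiver (m + 1)) (subspaceDim (m + 1))}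
    (h : IsIndecomposable M) : ∃ c j, IsNormalAt c j ∧ Iso M (ofPoints c) := by
  have h3 := hasThreeLines_of_isIndecomposable h
  obtain ⟨i, j, hij, hi, hj, hd, hl⟩ := exists_first_independent_triple h3
  set v := column M
  set β := planeDet (v 0) (v j)
  set γ := planeDet (v i) (v j)
  -- The rows are `β * planeDet (v i) ·` and `γ * planeDet (v 0) ·`. So `v 0` goes to `∞`, `v i` to
  -- `0`, and the factors `β`, `γ` make both coordinates of the image of `v j` equal to `β * γ`,
  -- which is the point `1`.
  let A : Matrix (Fin 2) (Fin 2) k :=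
    !![-(β * v i 1), β * v i 0; -(γ * v 0 1), γ * v 0 0]
  have hA : A.det ≠ 0 := by
    have : A.det = -(β * γ) * planeDet (v 0) (v i) := by
      simp only [A, Matrix.det_fin_two_of, planeDet]; ring
    rw [this]
    exact mul_ne_zero (neg_ne_zero.2 (mul_ne_zero hj hd)) hi
  have hA0 : ∀ x, A.mulVec x 0 = β * planeDet (v i) x := fun x => by
    simp only [A, Matrix.mulVec, dotProduct, Fin.sum_univ_two, planeDet, Matrix.of_apply,
      Matrix.cons_val_zero, Matrix.cons_val_one]; ring
  have hA1 : ∀ x, A.mulVec x 1 = γ * planeDet (v 0) x := fun x => by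
    simp only [A, Matrix.mulVec, dotProduct, Fin.sum_univ_two, planeDet, Matrix.of_apply,
      Matrix.cons_val_zero, Matrix.cons_val_one]; ring
  have hne : ∀ l, A.mulVec (v l) ≠ 0 := by
    intro l h0
    have h1 : ∀ w, planeDet (v l) w = 0 := fun w => by
      have := planeDet_mulVec A (v l) w
      rw [h0] at this
      refine (mul_eq_zero.1 (this.symm.trans ?_)).resolve_left hA
      simp [planeDet]
    obtain ⟨w, hw⟩ := exists_planeDet_ne_zero (h3.1 l)
    exact hw (h1 w)
  choose c s hcs using fun l => exists_eq_smul_pointVec (hne l)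
  have hnone : ∀ l, planeDet (v 0) (v l) = 0 → c l = none := by
    intro l h0
    have h1 := congrFun (hcs l) 1
    rw [hA1, h0, mul_zero] at h1
    cases hc : c l with
    | none => rfl
    | some t => exact absurd (by simpa [hc, pointVec] using h1.symm) (s l).ne_zero
  have hzero : ∀ l, planeDet (v i) (v l) = 0 → c l = some 0 := by
    intro l h0
    have h1 := congrFun (hcs l) 0
    rw [hA0, h0, mul_zero] at h1
    cases hc : c l with
    | none => exact absurd (by simpa [hc, pointVec] using h1.symm) (s l).ne_zero
    | some t => simpa [hc, pointVec] using h1.symm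
  refine ⟨c, j, ⟨hnone 0 (planeDet_self _), ?_, ⟨i, hij, hzero i (planeDet_self _)⟩,
    fun l hlj => (hl l hlj).imp (hnone l) (hzero l)⟩, ?_⟩
  · have h0 := congrFun (hcs j) 0
    have h1 := congrFun (hcs j) 1
    rw [hA0] at h0
    rw [hA1] at h1
    have h2 : β * γ = γ * β := mul_comm _ _
    have h3 : ((s j : k) • pointVec (c j)) 0 = ((s j : k) • pointVec (c j)) 1 := by
      rw [← h0, ← h1]; exact h2
    cases hc : c j with
    | none => simp [hc, pointVec] at h3
    | some t => simpa [hc, pointVec] using h3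
  · exact iso_iff_columns.2 ⟨Matrix.GeneralLinearGroup.mkOfDetNeZero A hA, s, hcs⟩

/-! ### Uniqueness of the normal form -/

/-- An isomorphism multiplies the determinants of pairs of columns by units, so it preserves which
points coincide. -/
theorem iso_ofPoints_eq_iff {c c' : Fin n → Option k} (h : Iso (ofPoints c) (ofPoints c'))
    (i l : Fin n) : c i = c l ↔ c' i = c' l := by
  obtain ⟨g, s, hg⟩ := iso_iff_columns.1 h
  have h1 := planeDet_mulVec (g : Matrix (Fin 2) (Fin 2) k) (pointVec (c i)) (pointVec (c l))
  have hi := hg i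
  have hl := hg l
  simp only [column_ofPoints] at hi hl
  rw [hi, hl, planeDet_smul] at h1
  have hdet : (g : Matrix (Fin 2) (Fin 2) k).det ≠ 0 :=
    (Matrix.GeneralLinearGroup.det g).ne_zero
  rw [← planeDet_pointVec_eq_zero_iff, ← planeDet_pointVec_eq_zero_iff]
  constructor <;> intro h0
  · rw [h0, mul_zero] at h1
    exact (mul_eq_zero.1 h1).resolve_left (mul_ne_zero (s i).ne_zero (s l).ne_zero)
  · rw [h0, mul_zero] at h1
    exact (mul_eq_zero.1 h1.symm).resolve_left hdet

/-- Equal coincidence patterns put the points `∞`, `0`, `1` at the same places `0`, `i`, `j`. A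
projective map that fixes these three points is the identity. The assumption `j ≤ j'` ensures that
place `i` comes before `j'`, where `c'` takes only the values `∞` and `0`. -/
theorem IsNormalAt.eq_of_iso_of_le {c c' : Fin (m + 1) → Option k} {j j' : Fin (m + 1)}
    (h : IsNormalAt c j) (h' : IsNormalAt c' j') (hjj : j ≤ j')
    (hiso : Iso (ofPoints c) (ofPoints c')) : c = c' := by
  have heq := iso_ofPoints_eq_iff hiso
  obtain ⟨h0, hj, ⟨i, hij, hi⟩, -⟩ := h
  obtain ⟨h0', hj', -, hl'⟩ := h'
  have hi' : c' i = some 0 := by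
    refine (hl' i (hij.trans_le hjj)).resolve_left fun hn => ?_
    have := (heq i 0).2 (hn.trans h0'.symm)
    simp [h0, hi] at this
  have hjeq : j = j' := by
    by_contra hne
    rcases hl' j (lt_of_le_of_ne hjj hne) with hn | hn
    · have := (heq j 0).2 (hn.trans h0'.symm)
      simp [h0, hj] at this
    · have := (heq j i).2 (hn.trans hi'.symm)
      simp [hi, hj] at this
  subst hjeq
  obtain ⟨g, s, hg⟩ := iso_iff_columns.1 hiso
  have hgc : ∀ l r, (g : Matrix (Fin 2) (Fin 2) k) r 0 * pointVec (c l) 0 +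
      (g : Matrix (Fin 2) (Fin 2) k) r 1 * pointVec (c l) 1 = s l * pointVec (c' l) r := by
    intro l r
    have := congrFun (hg l) r
    simpa only [column_ofPoints, Matrix.mulVec, dotProduct, Fin.sum_univ_two, Pi.smul_apply,
      smul_eq_mul] using this
  have e10 := hgc 0 1
  have e01 := hgc i 0
  have ej0 := hgc j 0
  have ej1 := hgc j 1
  simp only [h0, h0', hi, hi', hj, hj', pointVec, Matrix.cons_val_zero, Matrix.cons_val_one,
    mul_one, mul_zero, add_zero, zero_add] at e10 e01 ej0 ej1
  -- Fixing `∞` and `0` kills the off-diagonal entries of `g`, and fixing `1` makes both diagonal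
  -- entries equal to `s j`.
  rw [e01, add_zero] at ej0
  rw [e10, zero_add] at ej1
  funext l
  rw [← planeDet_pointVec_eq_zero_iff]
  have l0 := hgc l 0
  have l1 := hgc l 1
  rw [e01, ej0, zero_mul, add_zero] at l0
  rw [e10, ej1, zero_mul, zero_add] at l1
  have hs := (s j).ne_zero
  refine (mul_eq_zero.1 (?_ : (s j : k) * _ = 0)).resolve_left hs
  unfold planeDet
  linear_combination pointVec (c' l) 1 * l0 - pointVec (c' l) 0 * l1

theorem IsNormalAt.eq_of_iso {c c' : Fin (m + 1) → Option k} {j j' : Fin (m + 1)}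
    (h : IsNormalAt c j) (h' : IsNormalAt c' j')
    (hiso : Iso (ofPoints c) (ofPoints c')) : c = c' := by
  rcases le_total j j' with hle | hle
  · exact h.eq_of_iso_of_le h' hle hiso
  · exact (h'.eq_of_iso_of_le h hle hiso.symm).symm

/-! ### Cells -/

/-- The discrete data of a cell: the place of the point `1` and the set of places where the point
is not `∞`. -/
abbrev CellIndex (m : ℕ) : Type :=
  { p : Fin (m + 1) × (Fin (m + 1) → Bool) //
    p.2 0 = false ∧ (∃ i < p.1, p.2 i = true) ∧ p.2 p.1 = true }

/-- The configuration in the cell `p` with parameters `t`. -/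
def cellPoints (p : CellIndex m) (t : Fin (m + 1) → k) :
    Fin (m + 1) → Option k :=
  fun i => if p.1.2 i = true then some ((if i = p.1.1 then 1 else 0) + t i) else none

/-- The centre of the cell `p`. -/
def cellCenter (k : Type u) [Field k] (p : CellIndex m) :
    Rep k (SubspaceQuiver (m + 1)) (subspaceDim (m + 1)) :=
  ofPoints (cellPoints p 0)

/-- The parameter space of the cell `p`. -/
def cellSpace (k : Type u) [Field k] (p : CellIndex m) :
    Submodule k (Rep k (SubspaceQuiver (m + 1)) (subspaceDim (m + 1))) where
  carrier := {x | ∀ i, column x i 1 = 0 ∧ (¬ (p.1.1 < i ∧ p.1.2 i = true) → column x i 0 = 0)}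
  zero_mem' := fun i => ⟨rfl, fun _ => rfl⟩
  add_mem' := fun {x y} hx hy i => by
    rw [column_add, Pi.add_apply, Pi.add_apply]
    exact ⟨by rw [(hx i).1, (hy i).1, add_zero],
      fun h => by rw [(hx i).2 h, (hy i).2 h, add_zero]⟩
  smul_mem' := fun a x hx i => by
    have e : column (a • x) i = a • column x i := rfl
    rw [e, Pi.smul_apply, Pi.smul_apply]
    exact ⟨by rw [(hx i).1, smul_zero], fun h => by rw [(hx i).2 h, smul_zero]⟩

theorem mem_cellSpace {p : CellIndex m}
    {x : Rep k (SubspaceQuiver (m + 1)) (subspaceDim (m + 1))} :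
    x ∈ cellSpace k p ↔
      ∀ i, column x i 1 = 0 ∧ (¬ (p.1.1 < i ∧ p.1.2 i = true) → column x i 0 = 0) :=
  Iff.rfl

theorem ext_cellSpace {p : CellIndex m}
    {x y : Rep k (SubspaceQuiver (m + 1)) (subspaceDim (m + 1))}
    (hx : x ∈ cellSpace k p) (hy : y ∈ cellSpace k p)
    (h : ∀ i, p.1.1 < i → p.1.2 i = true → column x i 0 = column y i 0) : x = y := by
  refine ext_column fun i => funext fun r => ?_
  fin_cases r
  · by_cases hi : p.1.1 < i ∧ p.1.2 i = true
    · exact h i hi.1 hi.2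
    · exact ((hx i).2 hi).trans ((hy i).2 hi).symm
  · exact (hx i).1.trans (hy i).1.symm

/-- Adding `(t, 0)` to the vector `(a, 1)` of a finite point translates its affine coordinate by
`t`; at a point `∞` the parameter is zero. -/
theorem cellCenter_add {p : CellIndex m}
    {x : Rep k (SubspaceQuiver (m + 1)) (subspaceDim (m + 1))} (hx : x ∈ cellSpace k p) :
    cellCenter k p + x = ofPoints (cellPoints p fun i => column x i 0) := by
  refine ext_column fun i => ?_
  rw [column_add, cellCenter, column_ofPoints, column_ofPoints, cellPoints, cellPoints]
  obtain ⟨h1, h0⟩ := hx i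
  by_cases hi : p.1.2 i = true
  · rw [if_pos hi, if_pos hi]
    funext r
    fin_cases r <;> simp [pointVec, h1]
  · rw [if_neg hi, if_neg hi]
    have h0' := h0 fun h => hi h.2
    funext r
    fin_cases r <;> simp [pointVec, h1, h0']

theorem isNormalAt_cellPoints {p : CellIndex m} {t : Fin (m + 1) → k}
    (ht : ∀ i ≤ p.1.1, t i = 0) : IsNormalAt (cellPoints p t) p.1.1 := by
  obtain ⟨⟨j, s⟩, h0, ⟨i, hij, hi⟩, hj⟩ := p
  simp only at h0 hij hi hj ht
  refine ⟨by simp [cellPoints, h0], by simp [cellPoints, hj, ht j le_rfl],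
    ⟨i, hij, by simp [cellPoints, hi, hij.ne, ht i hij.le]⟩, fun l hl => ?_⟩
  by_cases hs : s l = true
  · exact Or.inr (by simp [cellPoints, hs, hl.ne, ht l hl.le])
  · exact Or.inl (by simp [cellPoints, hs])

theorem isNormalAt_of_mem_cellSpace {p : CellIndex m}
    {x : Rep k (SubspaceQuiver (m + 1)) (subspaceDim (m + 1))} (hx : x ∈ cellSpace k p) :
    IsNormalAt (cellPoints p fun i => column x i 0) p.1.1 :=
  isNormalAt_cellPoints fun i hi => (hx i).2 fun h => h.1.not_ge hi

theorem cellPoints_isSome (p : CellIndex m) (t : Fin (m + 1) → k) (i : Fin (m + 1)) :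
    (cellPoints p t i).isSome = p.1.2 i := by
  unfold cellPoints
  by_cases h : p.1.2 i = true <;> simp [h]

theorem cellPoints_eq_of_iso {p q : CellIndex m}
    {x y : Rep k (SubspaceQuiver (m + 1)) (subspaceDim (m + 1))} (hx : x ∈ cellSpace k p)
    (hy : y ∈ cellSpace k q) (h : Iso (cellCenter k p + x) (cellCenter k q + y)) :
    cellPoints p (fun i => column x i 0) = cellPoints q fun i => column y i 0 := by
  rw [cellCenter_add hx, cellCenter_add hy] at h
  exact (isNormalAt_of_mem_cellSpace hx).eq_of_iso (isNormalAt_of_mem_cellSpace hy) h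

theorem cellIndex_eq_of_iso {p q : CellIndex m}
    {x y : Rep k (SubspaceQuiver (m + 1)) (subspaceDim (m + 1))} (hx : x ∈ cellSpace k p)
    (hy : y ∈ cellSpace k q) (h : Iso (cellCenter k p + x) (cellCenter k q + y)) : p = q := by
  have he := cellPoints_eq_of_iso hx hy h
  have hn := isNormalAt_of_mem_cellSpace hx
  rw [he] at hn
  refine Subtype.ext (Prod.ext (hn.index_unique (isNormalAt_of_mem_cellSpace hy))
    (funext fun i => ?_))
  rw [← cellPoints_isSome p (fun i => column x i 0), he, cellPoints_isSome]

theorem isSeparating_cellSpace (p : CellIndex m) :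
    IsSeparating (cellCenter k p) (cellSpace k p : Set _) := by
  intro x hx y hy hne h
  refine hne (ext_cellSpace hx hy fun i _ hi => ?_)
  have he := congrFun (cellPoints_eq_of_iso hx hy h) i
  simpa [cellPoints, hi] using he

theorem isStrong_cellSpace (p : CellIndex m) :
    IsStrong (cellCenter k p) (cellSpace k p : Set _) := fun x hx => by
  rw [cellCenter_add hx]
  exact (isNormalAt_of_mem_cellSpace hx).isIndecomposable

theorem exists_cell {c : Fin (m + 1) → Option k} {j : Fin (m + 1)} (h : IsNormalAt c j) :
    ∃ p : CellIndex m, ∃ x ∈ cellSpace k p, ofPoints c = cellCenter k p + x := by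
  obtain ⟨h0, hj, ⟨i, hij, hi⟩, hl⟩ := h
  let p : CellIndex m := ⟨(j, fun i => (c i).isSome), by simp [h0], ⟨i, hij, by simp [hi]⟩,
    by simp [hj]⟩
  let x : Rep k (SubspaceQuiver (m + 1)) (subspaceDim (m + 1)) :=
    -- The default `0` at a point `∞` is what `cellSpace` requires there.
    ofColumns fun i => ![if j < i then (c i).getD 0 else 0, 0]
  have hx : x ∈ cellSpace k p := by
    refine mem_cellSpace.2 fun l => ⟨rfl, fun hn => ?_⟩
    change (if j < l then (c l).getD 0 else 0) = 0
    split_ifs with hjl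
    · cases hc : c l with
      | none => rfl
      | some t => exact absurd ⟨hjl, by simp [p, hc]⟩ hn
    · rfl
  refine ⟨p, x, hx, ?_⟩
  rw [cellCenter_add hx]
  congr 1
  funext l
  change c l = if (c l).isSome = true then
    some ((if l = j then 1 else 0) + if j < l then (c l).getD 0 else 0) else none
  rcases lt_trichotomy l j with hlt | rfl | hlt
  · rcases hl l hlt with hc | hc <;> simp [hc, hlt.ne, hlt.not_gt]
  · simp [hj]
  · cases hc : c l <;> simp [hlt.ne', hlt]

/-- In columns the differential is `A * N_i - s_i * M_i`, with `A` at the centre and a scalar `s_i`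
at each leaf. -/
theorem exists_column_extDifferential {n : ℕ}
    (N M : Rep k (SubspaceQuiver n) (subspaceDim n))
    (f : ∀ x : SubspaceQuiver n, Matrix (Fin (subspaceDim n x)) (Fin (subspaceDim n x)) k) :
    ∃ (A : Matrix (Fin 2) (Fin 2) k) (s : Fin n → k), ∀ i r,
      column (extDifferential N M f) i r =
        A r 0 * column N i 0 + A r 1 * column N i 1 - s i * column M i r := by
  refine ⟨f SubspaceQuiver.center,
    fun i => (show Matrix (Fin 1) (Fin 1) k from f (SubspaceQuiver.leaf i)) 0 0, fun i r => ?_⟩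
  refine congrArg₂ (· - ·) ?_ (Eq.trans
    (Fin.sum_univ_one (fun j : Fin 1 => M _ _ (SubspaceQuiver.Arrow.arrow i) r j *
      (show Matrix (Fin 1) (Fin 1) k from f (SubspaceQuiver.leaf i)) j 0)) (mul_comm _ _))
  exact Fin.sum_univ_two (fun j : Fin 2 =>
    (show Matrix (Fin 2) (Fin 2) k from f SubspaceQuiver.center) r j * column N i j)

theorem column_cellCenter (p : CellIndex m) (i : Fin (m + 1)) :
    column (cellCenter k p) i = pointVec (cellPoints p (0 : Fin (m + 1) → k) i) := rfl

/-- At a place `i` before `j` with point `0`, the column of the centre is `(0, 1)`, so the first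
coordinate of the differential is `A 0 1`; it must vanish as `i` carries no parameter. At every
place with a parameter the column is also `(0, 1)`, so the parameter is again `A 0 1 = 0`. -/
theorem eq_zero_of_mem_cellSpace_of_mem_range {p : CellIndex m}
    {x : Rep k (SubspaceQuiver (m + 1)) (subspaceDim (m + 1))} (hx : x ∈ cellSpace k p)
    (h : x ∈ LinearMap.range (extDifferential (cellCenter k p) (cellCenter k p))) : x = 0 := by
  obtain ⟨f, rfl⟩ := h
  obtain ⟨A, s, hc⟩ := exists_column_extDifferential (cellCenter k p) (cellCenter k p) f
  simp only [column_cellCenter] at hc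
  obtain ⟨-, -, ⟨i, hij, hi⟩, -⟩ :=
    isNormalAt_cellPoints (p := p) (t := (0 : Fin (m + 1) → k)) fun _ _ => rfl
  have ei := (hx i).2 fun h => h.1.not_gt hij
  rw [hc] at ei
  simp only [hi, pointVec, Matrix.cons_val_zero, Matrix.cons_val_one, mul_one, mul_zero,
    zero_add, sub_zero] at ei
  refine ext_cellSpace hx (Submodule.zero_mem _) fun l hl hs => ?_
  have hpl : cellPoints p (0 : Fin (m + 1) → k) l = some 0 := by
    simp [cellPoints, hs, hl.ne']
  rw [hc, hpl]
  simp only [pointVec, Matrix.cons_val_zero, Matrix.cons_val_one, ei, mul_zero, zero_mul,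
    add_zero, sub_zero]
  rfl

theorem isCell_cellSpace (p : CellIndex m) : IsCell (cellCenter k p) (cellSpace k p) := by
  have hinj : Set.InjOn (extProj (cellCenter k p) (cellCenter k p)) (cellSpace k p) := by
    intro x hx y hy hxy
    have h := (Submodule.Quotient.eq _).1 hxy
    exact sub_eq_zero.1 (eq_zero_of_mem_cellSpace_of_mem_range (Submodule.sub_mem _ hx hy) h)
  exact ⟨⟨_, hinj.bijOn_image⟩, isStrong_cellSpace p, isSeparating_cellSpace p⟩

/-! ### The centres of the cells are tree modules -/

/-- A place of a nonzero coefficient in each column of the centre of a cell. -/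
def cellRow (p : CellIndex m) (i : Fin (m + 1)) : Fin 2 := if p.1.2 i = true then 1 else 0

/-- The columns of the centre are `(1, 0)` and `(0, 1)`, except for `(1, 1)` at the place of the
point `1`. -/
theorem column_cellCenter_ne_zero_iff (p : CellIndex m) (i : Fin (m + 1)) (r : Fin 2) :
    column (cellCenter k p) i r ≠ 0 ↔ r = cellRow p i ∨ (i = p.1.1 ∧ r = 0) := by
  rw [column_cellCenter, cellPoints, cellRow]
  have hj := p.2.2.2
  by_cases hs : p.1.2 i = true
  · by_cases hi : i = p.1.1
    · fin_cases r <;> simp [hj, hi, pointVec]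
    · fin_cases r <;> simp [hs, hi, pointVec]
  · have hi : i ≠ p.1.1 := fun h => hs (h ▸ hj)
    fin_cases r <;> simp [hs, hi, pointVec]

/-- The basis vectors at the central vertex. -/
def centerVertex (n : ℕ) (r : Fin 2) : CoeffVertex (subspaceDim n) :=
  ⟨SubspaceQuiver.center, r⟩

/-- The basis vector at a leaf. -/
def leafVertex {n : ℕ} (i : Fin n) : CoeffVertex (subspaceDim n) :=
  ⟨SubspaceQuiver.leaf i, (0 : Fin 1)⟩

theorem coeffVertex_cases {n : ℕ} (b : CoeffVertex (subspaceDim n)) :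
    (∃ r, b = centerVertex n r) ∨ ∃ i, b = leafVertex i := by
  obtain ⟨x, r⟩ := b
  cases x with
  | center => exact Or.inl ⟨r, rfl⟩
  | leaf i =>
    refine Or.inr ⟨i, ?_⟩
    have hr : r = (0 : Fin 1) := Subsingleton.elim (α := Fin 1) r 0
    rw [hr]
    rfl

theorem natCard_coeffVertex (n : ℕ) : Nat.card (CoeffVertex (subspaceDim n)) = n + 2 := by
  have hb : Function.Bijective
      (Sum.elim (fun i : Fin n => leafVertex i) (centerVertex n)) := by
    constructor
    · rintro (i | r) (j | s) h
      · cases h; rfl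
      · cases h
      · cases h
      · cases h; rfl
    · intro b
      rcases coeffVertex_cases b with ⟨r, rfl⟩ | ⟨i, rfl⟩
      · exact ⟨Sum.inr r, rfl⟩
      · exact ⟨Sum.inl i, rfl⟩
  rw [← Nat.card_eq_of_bijective _ hb, Nat.card_sum, Nat.card_fin, Nat.card_fin]

/-- The arrow of the coefficient quiver that belongs to a nonzero coefficient. -/
def coeffArrow {n : ℕ} (M : Rep k (SubspaceQuiver n) (subspaceDim n)) (i : Fin n) (r : Fin 2)
    (h : column M i r ≠ 0) :
    Σ b' : CoeffVertex (subspaceDim n), Σ b : CoeffVertex (subspaceDim n), CoeffArrow M b' b :=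
  ⟨leafVertex i, centerVertex n r, ⟨SubspaceQuiver.Arrow.arrow i, h⟩⟩

theorem exists_coeffArrow_eq {n : ℕ} {M : Rep k (SubspaceQuiver n) (subspaceDim n)}
    (a : Σ b' : CoeffVertex (subspaceDim n), Σ b : CoeffVertex (subspaceDim n),
      CoeffArrow M b' b) : ∃ i r h, a = coeffArrow M i r h := by
  obtain ⟨⟨x, s⟩, ⟨y, r⟩, ⟨a, h⟩⟩ := a
  change SubspaceQuiver.Arrow n x y at a
  cases a with
  | arrow i =>
    have hs : s = (0 : Fin 1) := Subsingleton.elim (α := Fin 1) s 0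
    subst hs
    exact ⟨i, r, h, rfl⟩

theorem coeffArrow_inj {n : ℕ} {M : Rep k (SubspaceQuiver n) (subspaceDim n)} {i j : Fin n}
    {r s : Fin 2} {h : column M i r ≠ 0} {h' : column M j s ≠ 0}
    (e : coeffArrow M i r h = coeffArrow M j s h') : i = j ∧ r = s := by
  have e1 : leafVertex i = leafVertex j := congrArg Sigma.fst e
  have e2 : centerVertex n r = centerVertex n s := congrArg (fun a => a.2.1) e
  constructor
  · cases e1; rfl
  · cases e2; rfl

/-- There is one arrow for each leaf, and `none` stands for the second entry of the column `(1, 1)`.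
This gives `m + 2` arrows, one fewer than the `m + 3` vertices. -/
theorem exists_bijective_coeffArrow (p : CellIndex m) :
    ∃ F : Option (Fin (m + 1)) → Σ b' : CoeffVertex (subspaceDim (m + 1)),
      Σ b : CoeffVertex (subspaceDim (m + 1)), CoeffArrow (cellCenter k p) b' b,
      Function.Bijective F := by
  have hrow : cellRow p p.1.1 = 1 := if_pos p.2.2.2
  refine ⟨fun o => match o with
    | none => coeffArrow _ p.1.1 0 ((column_cellCenter_ne_zero_iff p _ _).2 (Or.inr ⟨rfl, rfl⟩))
    | some i => coeffArrow _ i (cellRow p i)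
        ((column_cellCenter_ne_zero_iff p _ _).2 (Or.inl rfl)), ?_, ?_⟩
  · rintro (_ | i) (_ | j) h
    · rfl
    · obtain ⟨rfl, h2⟩ := coeffArrow_inj h
      rw [hrow] at h2
      exact absurd h2 (by decide)
    · obtain ⟨rfl, h2⟩ := coeffArrow_inj h
      rw [hrow] at h2
      exact absurd h2 (by decide)
    · rw [(coeffArrow_inj h).1]
  · intro a
    obtain ⟨i, r, h, rfl⟩ := exists_coeffArrow_eq a
    rcases (column_cellCenter_ne_zero_iff p i r).1 h with rfl | ⟨rfl, rfl⟩
    · exact ⟨some i, rfl⟩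
    · exact ⟨none, rfl⟩

theorem coeffGraph_adj {n : ℕ} {M : Rep k (SubspaceQuiver n) (subspaceDim n)} {i : Fin n}
    {r : Fin 2} (h : column M i r ≠ 0) :
    (coeffGraph M).Adj (leafVertex i) (centerVertex n r) := by
  rw [coeffGraph, SimpleGraph.fromRel_adj]
  exact ⟨fun e => (by cases e), Or.inl ⟨⟨SubspaceQuiver.Arrow.arrow i, h⟩⟩⟩

/-- The leaf with column `(1, 1)` joins the two central basis vectors, and every leaf is joined to
one of them. -/
theorem connected_coeffGraph_cellCenter (p : CellIndex m) :
    (coeffGraph (cellCenter k p)).Connected := by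
  have hrow : cellRow p p.1.1 = 1 := if_pos p.2.2.2
  have a0 := coeffGraph_adj ((column_cellCenter_ne_zero_iff (k := k) p p.1.1 0).2
    (Or.inr ⟨rfl, rfl⟩))
  have a1 := coeffGraph_adj ((column_cellCenter_ne_zero_iff (k := k) p p.1.1 1).2
    (Or.inl hrow.symm))
  have hc : ∀ r, (coeffGraph (cellCenter k p)).Reachable (centerVertex (m + 1) r)
      (leafVertex p.1.1) := by
    intro r
    fin_cases r
    · exact a0.symm.reachable
    · exact a1.symm.reachable
  have : Nonempty (CoeffVertex (subspaceDim (m + 1))) := ⟨leafVertex p.1.1⟩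
  rw [SimpleGraph.connected_iff_exists_forall_reachable]
  refine ⟨leafVertex p.1.1, fun b => SimpleGraph.Reachable.symm ?_⟩
  rcases coeffVertex_cases b with ⟨r, rfl⟩ | ⟨i, rfl⟩
  · exact hc r
  · exact (coeffGraph_adj ((column_cellCenter_ne_zero_iff (k := k) p i (cellRow p i)).2
      (Or.inl rfl))).reachable.trans (hc _)

theorem isTreeModule_cellCenter (p : CellIndex m) : IsTreeModule (cellCenter k p) := by
  obtain ⟨F, hF⟩ := exists_bijective_coeffArrow (k := k) p
  refine ⟨(isNormalAt_cellPoints fun _ _ => rfl).isIndecomposable,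
    connected_coeffGraph_cellCenter p, Finite.of_surjective F hF.2, ?_⟩
  rw [← Nat.card_eq_of_bijective F hF, natCard_coeffVertex, Finite.card_option, Nat.card_fin]

theorem admitsCellularTreeNormalForm_subspaceDim (k : Type u) [Field k] (m : ℕ) :
    AdmitsCellularTreeNormalForm k (SubspaceQuiver (m + 1)) (subspaceDim (m + 1)) := by
  classical
  let e := (Fintype.equivFin (CellIndex m)).symm
  refine ⟨Fintype.card (CellIndex m), fun i => cellCenter k (e i), fun i => cellSpace k (e i),
    fun i => isTreeModule_cellCenter _, ⟨fun i => isCell_cellSpace _,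
      fun i j x hx y hy h => e.injective (cellIndex_eq_of_iso hx hy h)⟩, fun M hM => ?_⟩
  obtain ⟨c, j, hc, hiso⟩ := exists_normal_form hM
  obtain ⟨p, x, hx, hp⟩ := exists_cell hc
  rw [hp] at hiso
  refine ⟨e.symm p, x, ?_, ?_⟩
  · simpa using hx
  · simpa using hiso

/-! ### Counting -/

/-- The configurations of points in normal form. -/
def normalForms (k : Type u) [Field k] (m : ℕ) : Set (Fin (m + 1) → Option k) :=
  {c | ∃ j, IsNormalAt c j}

/-- The configurations that start with `∞` and consist of the points `∞` and `0`, both of which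
occur. -/
def twoPointForms (k : Type u) [Field k] (m : ℕ) : Set (Fin (m + 1) → Option k) :=
  {c | c 0 = none ∧ (∀ i, c i = none ∨ c i = some 0) ∧ ∃ i, c i = some 0}

/-- Normal forms are a set of representatives: each class contains one, and isomorphic ones are
equal. -/
theorem absIndecCount_eq_ncard_normalForms (k : Type u) [Field k] (m : ℕ) :
    absIndecCount k (SubspaceQuiver (m + 1)) (subspaceDim (m + 1)) =
      (normalForms k m).ncard := by
  have himage : Quotient.mk (isoSetoid k (SubspaceQuiver (m + 1)) (subspaceDim (m + 1))) ''
      {M | IsAbsolutelyIndecomposable M} =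
      (fun c => Quotient.mk (isoSetoid k _ _) (ofPoints c)) '' normalForms k m := by
    ext q
    constructor
    · rintro ⟨M, hM, rfl⟩
      obtain ⟨c, j, hc, hiso⟩ := exists_normal_form (isAbsolutelyIndecomposable_iff.1 hM)
      exact ⟨c, ⟨j, hc⟩, Quotient.sound hiso.symm⟩
    · rintro ⟨c, ⟨j, hc⟩, rfl⟩
      exact ⟨_, isAbsolutelyIndecomposable_iff.2 hc.isIndecomposable, rfl⟩
  rw [absIndecCount, himage]
  refine Set.InjOn.ncard_image ?_
  rintro c ⟨j, hc⟩ c' ⟨j', hc'⟩ h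
  exact hc.eq_of_iso hc' (Quotient.exact h)

/-! ### Removing the last point -/

theorem snoc_injective2 (α : Type*) (n : ℕ) :
    Function.Injective fun x : (Fin n → α) × α => (Fin.snoc x.1 x.2 : Fin (n + 1) → α) := by
  rintro ⟨c, a⟩ ⟨c', a'⟩ h
  obtain ⟨h1, h2⟩ := Fin.snoc_injective2 h
  exact Prod.ext h1 h2

/-- Normality at `j` constrains only the entries up to `j`, so an entry appended after it is free.
-/
theorem isNormalAt_snoc_castSucc_iff {c : Fin (m + 1) → Option k} {o : Option k}
    {j : Fin (m + 1)} :
    IsNormalAt (Fin.snoc c o : Fin (m + 2) → Option k) j.castSucc ↔ IsNormalAt c j := by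
  unfold IsNormalAt
  rw [← Fin.castSucc_zero]
  simp only [Fin.snoc_castSucc, Fin.forall_fin_succ', Fin.exists_fin_succ',
    Fin.castSucc_lt_castSucc_iff, Fin.snoc_last]
  simp [Fin.lt_def, j.is_lt.not_gt]

theorem isNormalAt_snoc_last_iff {c : Fin (m + 1) → Option k} {o : Option k} :
    IsNormalAt (Fin.snoc c o : Fin (m + 2) → Option k) (Fin.last _) ↔
      c ∈ twoPointForms k m ∧ o = some 1 := by
  unfold IsNormalAt twoPointForms
  rw [← Fin.castSucc_zero]
  simp only [Fin.snoc_castSucc, Fin.forall_fin_succ', Fin.exists_fin_succ',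
    Fin.snoc_last, Fin.castSucc_lt_last, lt_irrefl, true_and, false_and, or_false,
    forall_true_left, false_imp_iff, and_true, Set.mem_ofPred_eq]
  tauto

theorem normalForms_succ (k : Type u) [Field k] (m : ℕ) :
    normalForms k (m + 1) =
      (fun x : (Fin (m + 1) → Option k) × Option k =>
        (Fin.snoc x.1 x.2 : Fin (m + 2) → Option k)) ''
        (normalForms k m ×ˢ Set.univ ∪ twoPointForms k m ×ˢ {some 1}) := by
  ext c
  constructor
  · rintro ⟨j, hj⟩
    rw [← Fin.snoc_init_self c] at hj
    refine ⟨(Fin.init c, c (Fin.last _)), ?_, Fin.snoc_init_self c⟩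
    induction j using Fin.lastCases with
    | last => exact Or.inr (isNormalAt_snoc_last_iff.1 hj)
    | cast j => exact Or.inl ⟨⟨j, isNormalAt_snoc_castSucc_iff.1 hj⟩, Set.mem_univ _⟩
  · rintro ⟨⟨c, o⟩, ⟨⟨j, hj⟩, -⟩ | h, rfl⟩
    · exact ⟨j.castSucc, isNormalAt_snoc_castSucc_iff.2 hj⟩
    · exact ⟨Fin.last _, isNormalAt_snoc_last_iff.2 h⟩

/-- Either `0` occurs before the last place, which is then free to be `∞` or `0`, or the word is `∞`
throughout until a final `0`. -/
theorem twoPointForms_succ (k : Type u) [Field k] (m : ℕ) :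
    twoPointForms k (m + 1) =
      (fun x : (Fin (m + 1) → Option k) × Option k =>
        (Fin.snoc x.1 x.2 : Fin (m + 2) → Option k)) ''
        (twoPointForms k m ×ˢ {none, some 0} ∪ {(fun _ => none, some 0)}) := by
  have key : ∀ (c : Fin (m + 1) → Option k) (o : Option k),
      (Fin.snoc c o : Fin (m + 2) → Option k) ∈ twoPointForms k (m + 1) ↔
        (c, o) ∈ twoPointForms k m ×ˢ {none, some 0} ∪
          ({(fun _ => none, some 0)} : Set ((Fin (m + 1) → Option k) × Option k)) := by
    intro c o
    have h1 : (Fin.snoc c o : Fin (m + 2) → Option k) ∈ twoPointForms k (m + 1) ↔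
        c 0 = none ∧ ((∀ i, c i = none ∨ c i = some 0) ∧ (o = none ∨ o = some 0)) ∧
          ((∃ i, c i = some 0) ∨ o = some 0) := by
      unfold twoPointForms
      rw [Set.mem_ofPred_eq, ← Fin.castSucc_zero]
      simp only [Fin.snoc_castSucc, Fin.forall_fin_succ', Fin.exists_fin_succ', Fin.snoc_last]
    rw [h1]
    simp only [twoPointForms, Set.mem_union, Set.mem_prod, Set.mem_ofPred_eq,
      Set.mem_insert_iff, Set.mem_singleton_iff, Prod.mk.injEq]
    constructor
    · rintro ⟨h0, ⟨hc, ho⟩, hz⟩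
      by_cases he : ∃ i, c i = some 0
      · exact Or.inl ⟨⟨h0, hc, he⟩, ho⟩
      · exact Or.inr ⟨funext fun i => (hc i).resolve_right fun h => he ⟨i, h⟩,
          hz.resolve_left he⟩
    · rintro (⟨⟨h0, hc, he⟩, ho⟩ | ⟨rfl, rfl⟩)
      · exact ⟨h0, ⟨hc, ho⟩, Or.inl he⟩
      · exact ⟨rfl, ⟨fun _ => Or.inl rfl, Or.inr rfl⟩, Or.inr rfl⟩
  ext c
  constructor
  · intro h
    rw [← Fin.snoc_init_self c] at h
    exact ⟨(Fin.init c, c (Fin.last _)), (key _ _).1 h, Fin.snoc_init_self c⟩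
  · rintro ⟨⟨c, o⟩, h, rfl⟩
    exact (key _ _).2 h

/-- After the initial `∞` there are `m` binary choices; the added `1` is the excluded constant word
`∞`. -/
theorem ncard_twoPointForms (k : Type u) [Field k] [Finite k] (m : ℕ) :
    (twoPointForms k m).ncard + 1 = 2 ^ m := by
  induction m with
  | zero =>
    have : twoPointForms k 0 = ∅ := by
      refine Set.eq_empty_of_forall_notMem fun c => ?_
      rintro ⟨h0, -, i, hi⟩
      rw [Subsingleton.elim (α := Fin 1) i 0, h0] at hi
      simp at hi
    simp [this]
  | succ m ih =>
    have hd : Disjoint (twoPointForms k m ×ˢ ({none, some 0} : Set (Option k)))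
        {(fun _ => none, some 0)} := by
      rw [Set.disjoint_singleton_right]
      rintro ⟨⟨-, -, i, hi⟩, -⟩
      simp at hi
    rw [twoPointForms_succ, Set.ncard_image_of_injective _ (snoc_injective2 _ _),
      Set.ncard_union_eq hd, Set.ncard_prod, Set.ncard_singleton,
      Set.ncard_pair (by simp), pow_succ, ← ih]
    ring

theorem ncard_normalForms_succ (k : Type u) [Field k] [Finite k] (m : ℕ) :
    (normalForms k (m + 1)).ncard =
      (Nat.card k + 1) * (normalForms k m).ncard + (twoPointForms k m).ncard := by
  -- A normal form contains the point `1`, a word in `∞` and `0` does not.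
  have hd : Disjoint (normalForms k m ×ˢ (Set.univ : Set (Option k)))
      (twoPointForms k m ×ˢ {some 1}) := by
    rw [Set.disjoint_left]
    rintro ⟨c, o⟩ ⟨⟨j, -, hj, -⟩, -⟩ ⟨⟨-, h, -⟩, -⟩
    have := h j
    simp only at hj this
    simp [hj] at this
  rw [normalForms_succ, Set.ncard_image_of_injective _ (snoc_injective2 _ _),
    Set.ncard_union_eq hd, Set.ncard_prod, Set.ncard_prod, Set.ncard_singleton, Set.ncard_univ,
    Finite.card_option]
  ring

theorem normalForms_zero (k : Type u) [Field k] : normalForms k 0 = ∅ := by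
  refine Set.eq_empty_of_forall_notMem fun c => ?_
  rintro ⟨j, h0, hj, -⟩
  rw [Subsingleton.elim (α := Fin 1) j 0, h0] at hj
  simp at hj

/-! ### The Kac polynomials -/

/-- The polynomial that counts the configurations of `m + 1` points in normal form. -/
noncomputable def normalFormPoly : ℕ → ℤ[X]
  | 0 => 0
  | m + 1 => (X + 1) * normalFormPoly m + (2 ^ m - 1)

theorem eval_normalFormPoly (k : Type u) [Field k] [Finite k] (m : ℕ) :
    (normalFormPoly m).eval (Nat.card k : ℤ) = ((normalForms k m).ncard : ℤ) := by
  induction m with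
  | zero => simp [normalFormPoly, normalForms_zero]
  | succ m ih =>
    have h : ((twoPointForms k m).ncard : ℤ) + 1 = 2 ^ m := by
      exact_mod_cast ncard_twoPointForms k m
    rw [normalFormPoly, ncard_normalForms_succ]
    simp only [eval_add, eval_mul, eval_sub, eval_X, eval_one, eval_pow, eval_ofNat, ih]
    push_cast
    linear_combination -h

theorem isKacPolynomial_normalFormPoly (m : ℕ) :
    IsKacPolynomial (SubspaceQuiver (m + 1)) (subspaceDim (m + 1)) (normalFormPoly m) :=
  fun F _ _ => by rw [eval_normalFormPoly, absIndecCount_eq_ncard_normalForms]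

theorem IsKacPolynomial.kacPolynomial_eq {Q : Type*} [Quiver Q] {α : Q → ℕ} {p : ℤ[X]}
    (h : IsKacPolynomial Q α p) : kacPolynomial Q α = p := by
  have he : ∃ p : ℤ[X], IsKacPolynomial Q α p := ⟨p, h⟩
  rw [kacPolynomial, dif_pos he]
  exact he.choose_spec.unique h

theorem kacPolynomial_subspaceDim (m : ℕ) :
    kacPolynomial (SubspaceQuiver (m + 1)) (subspaceDim (m + 1)) = normalFormPoly m :=
  (isKacPolynomial_normalFormPoly m).kacPolynomial_eq

end QuiverRep

theorem mainTheorem6 :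
    (∀ (k : Type*) [Field k] (n : ℕ), 3 ≤ n →
      QuiverRep.AdmitsCellularTreeNormalForm k (QuiverRep.SubspaceQuiver n)
        (QuiverRep.subspaceDim n)) ∧
    (∀ n : ℕ, 3 ≤ n →
      QuiverRep.IsKacPolynomial (QuiverRep.SubspaceQuiver n) (QuiverRep.subspaceDim n)
        (QuiverRep.kacPolynomial (QuiverRep.SubspaceQuiver n) (QuiverRep.subspaceDim n))) ∧
    QuiverRep.kacPolynomial (QuiverRep.SubspaceQuiver 3) (QuiverRep.subspaceDim 3) = 1 ∧
    (∀ n : ℕ, 4 ≤ n →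
      QuiverRep.kacPolynomial (QuiverRep.SubspaceQuiver n) (QuiverRep.subspaceDim n) =
        (Polynomial.X + 1) *
            QuiverRep.kacPolynomial (QuiverRep.SubspaceQuiver (n - 1))
              (QuiverRep.subspaceDim (n - 1)) +
          2 ^ (n - 2) - 1) := by
  refine ⟨fun k _ n hn => ?_, fun n hn => ?_, ?_, fun n hn => ?_⟩
  · obtain ⟨m, rfl⟩ : ∃ m, n = m + 1 := ⟨n - 1, by omega⟩
    exact QuiverRep.admitsCellularTreeNormalForm_subspaceDim k m
  · obtain ⟨m, rfl⟩ : ∃ m, n = m + 1 := ⟨n - 1, by omega⟩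
    rw [QuiverRep.kacPolynomial_subspaceDim]
    exact QuiverRep.isKacPolynomial_normalFormPoly m
  · rw [QuiverRep.kacPolynomial_subspaceDim 2]
    -- The recursion starts from `0` for one subspace, and gives `0` for two and `2 - 1 = 1` for
    -- three.
    simp only [QuiverRep.normalFormPoly]
    ring
  · obtain ⟨m, rfl⟩ : ∃ m, n = m + 2 := ⟨n - 2, by omega⟩
    rw [show m + 2 - 1 = m + 1 from rfl, show m + 2 - 2 = m from rfl,
      QuiverRep.kacPolynomial_subspaceDim (m + 1), QuiverRep.kacPolynomial_subspaceDim m,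
      QuiverRep.normalFormPoly, add_sub_assoc]
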